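/- Let $\mathbb K$ be an algebraically closed field of characteristic $0$, let $q\in\mathbb K$ be nonzero and not a root of unity, and let $V$ be a vector space over $\mathbb K$ of finite positive dimension. Let $A,A^*$ be a tridiagonal pair on $V$; that is, $A,A^*:V\to V$ are linear maps such that (i) each of $A,A^*$ is diagonalizable; (ii) there is an ordering $V_0,\dots,V_d$ of the eigenspaces of $A$ with $A^*V_i\subseteq V_{i-1}+V_i+V_{i+1}$ for $0\le i\le d$, where $V_{-1}=V_{d+1}=0$; (iii) there is an ordering $V^*_0,\dots,V^*_\delta$ of the eigenspaces of $A^*$ with $AV^*_i\subseteq V^*_{i-1}+V^*_i+V^*_{i+1}$ for $0\le i\le\delta$, where $V^*_{-1}=V^*_{\delta+1}=0$; (iv) no subspace $W$ of $V$ other than $0$ and $V$ satisfies both $AW\subseteq W$ and $A^*W\subseteq W$. (It is known that $d=\delta$.) An ordering of the eigenvalues of $A$ (resp. $A^*$) is called standard if the corresponding ordering of the eigenspaces satisfies the inclusions in (ii) (resp. (iii)). Assume that, with $\beta=q^2+q^{-2}$ and $[r,s]=rs-sr$, $$[A,\;A^2A^*-\beta AA^*A+A^*A^2]=0,\qquad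 [A^*,\;A^{*2}A-\beta A^*AA^*+AA^{*2}]=0.$$ Let $\theta_0,\dots,\theta_d$ and $\theta^*_0,\dots,\theta^*_d$ be standard orderings of the eigenvalues of $A$ and of $A^*$ such that, for some $a,a^*\in\mathbb K$, $\theta_i=aq^{2i-d}$ and $\theta^*_i=a^*q^{d-2i}$ for $0\le i\le d$. Let $U_0,\dots,U_d$ be the corresponding split decomposition, i.e. the sequence of subspaces of $V$ with $V=U_0\oplus\cdots\oplus U_d$ and $$(A-\theta_iI)U_i\subseteq U_{i+1}\ (0\le i<d),\quad (A-\theta_dI)U_d=0,\quad (A^*-\theta^*_iI)U_i\subseteq U_{i-1}\ (0<i\le d),\quad (A^*-\theta^*_0I)U_0=0.$$ Let $F_i:V\to V$ be the projection onto $U_i$ along $\bigoplus_{j\ne i}U_j$, and let $R=A-\sum_{h=0}^d\theta_hF_h$ and $L=A^*-\sum_{h=0}^d\theta^*_hF_h$ be the raising and lowering maps. Let $v$ be a nonzero vector in $U_0$. Then for $0\le i\le d$ the space $U_i$ is spanned by the vectors $$L^{i_1}R^{i_2}L^{i_3}R^{i_4}\cdots R^{i_n}v,$$ where $(i_1,\dots,i_n)$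 ranges over all sequences of integers such that $n\ge 0$ is even, $0\le i_1<i_2<\cdots<i_n\le d$ and $i=\sum_{h=1}^n(-1)^hi_h$ (for $n=0$ the vector is $v$). Moreover, the number of such sequences is exactly $\binom di$. -/

import Mathlib

noncomputable section

namespace TDPair

variable {K V : Type*} [Field K] [AddCommGroup V] [Module K V]

/-- `V` is spanned by the eigenspaces of `A`. -/
def IsDiagonalizable (A : Module.End K V) : Prop :=
  ⨆ μ : K, A.eigenspace μ = ⊤

/-- `θ 0, …, θ d` lists the eigenvalues of `A`, each once, and the corresponding ordering
`V_0, …, V_d` of the eigenspaces of `A` satisfies `B V_i ⊆ V_{i-1} + V_i + V_{i+1}` for all `i`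
(where `V_{-1} = 0 = V_{d+1}`). -/
structure IsStandardOrdering (A B : Module.End K V) {d : ℕ} (θ : Fin (d + 1) → K) : Prop where
  injective : Function.Injective θ
  hasEigenvalue_iff : ∀ μ : K, A.HasEigenvalue μ ↔ ∃ i, θ i = μ
  map_le : ∀ i : Fin (d + 1), (A.eigenspace (θ i)).map B ≤
    ⨆ (j : Fin (d + 1)) (_ : (j : ℕ) ≤ i + 1 ∧ (i : ℕ) ≤ j + 1), A.eigenspace (θ j)

/-- The ordered pair `A, B` (with `B` in the role of `A^*`) is a tridiagonal pair on `V`. -/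
structure IsTridiagonalPair (A B : Module.End K V) : Prop where
  diagonalizable_left : IsDiagonalizable A
  diagonalizable_right : IsDiagonalizable B
  exists_ordering_left : ∃ (d : ℕ) (θ : Fin (d + 1) → K), IsStandardOrdering A B θ
  exists_ordering_right : ∃ (δ : ℕ) (θ : Fin (δ + 1) → K), IsStandardOrdering B A θ
  irreducible : ∀ W : Submodule K V, W.map A ≤ W → W.map B ≤ W → W = ⊥ ∨ W = ⊤

/-- The tridiagonal relation
`[A, A²B - β ABA + BA² - γ (AB + BA) - ϱ B] = 0`, where `[r, s] = rs - sr`. -/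
def TridiagonalRelation (β γ ϱ : K) (A B : Module.End K V) : Prop :=
  ⁅A, A ^ 2 * B - β • (A * B * A) + B * A ^ 2 - γ • (A * B + B * A) - ϱ • B⁆ = 0

/-- `U_0, …, U_d` is the split decomposition for `A, B` with respect to the orderings
`θ_0, …, θ_d` and `θ'_0, …, θ'_d` of the eigenvalues of `A` and of `B`. -/
structure IsSplitDecomposition (A B : Module.End K V) {d : ℕ} (θ θ' : Fin (d + 1) → K)
    (U : Fin (d + 1) → Submodule K V) : Prop where
  isInternal : DirectSum.IsInternal U
  raise : ∀ i j : Fin (d + 1), (j : ℕ) = i + 1 →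
    (U i).map (A - θ i • (1 : Module.End K V)) ≤ U j
  raise_last : (U (Fin.last d)).map (A - θ (Fin.last d) • (1 : Module.End K V)) = ⊥
  lower : ∀ i j : Fin (d + 1), (i : ℕ) = j + 1 →
    (U i).map (B - θ' i • (1 : Module.End K V)) ≤ U j
  lower_zero : (U 0).map (B - θ' 0 • (1 : Module.End K V)) = ⊥

theorem coe_bijective {d : ℕ} {U : Fin (d + 1) → Submodule K V} (hU : DirectSum.IsInternal U) :
    Function.Bijective (DirectSum.coeLinearMap U) := hU

/-- The projection `F_i : V → V` onto `U_i` along the direct sum `V = U_0 + ⋯ + U_d`. -/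
def proj {d : ℕ} {U : Fin (d + 1) → Submodule K V} (hU : DirectSum.IsInternal U)
    (i : Fin (d + 1)) : Module.End K V :=
  (U i).subtype ∘ₗ DirectSum.component K (Fin (d + 1)) (fun j => U j) i ∘ₗ
    (LinearEquiv.ofBijective (DirectSum.coeLinearMap U) (coe_bijective hU)).symm.toLinearMap

/-- `F_i` is the identity on `U_i` and vanishes on `U_j` for `j ≠ i`. -/
theorem proj_apply {d : ℕ} {U : Fin (d + 1) → Submodule K V} (hU : DirectSum.IsInternal U)
    (i j : Fin (d + 1)) {u : V} (hu : u ∈ U j) : proj hU i u = if j = i then u else 0 := by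
  have h : (LinearEquiv.ofBijective (DirectSum.coeLinearMap U) (coe_bijective hU)).symm u =
      DirectSum.lof K (Fin (d + 1)) (fun j => U j) j ⟨u, hu⟩ := by
    rw [LinearEquiv.symm_apply_eq]
    simp [DirectSum.coeLinearMap_lof]
  simp only [proj, LinearMap.comp_apply, LinearEquiv.coe_coe, h]
  split_ifs with hij
  · subst hij
    simp [DirectSum.component.lof_self]
  · rw [DirectSum.component.of, dif_neg hij]
    simp

/-- For `A` and `θ` this is the raising map `R = A - ∑ θ_h F_h`; for `A^*` and `θ^*` it is the
lowering map `L = A^* - ∑ θ^*_h F_h`. -/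
def shiftMap (A : Module.End K V) {d : ℕ} (θ : Fin (d + 1) → K)
    {U : Fin (d + 1) → Submodule K V} (hU : DirectSum.IsInternal U) : Module.End K V :=
  A - ∑ h : Fin (d + 1), θ h • proj hU h

/-- The alternating product `L^{i_1} R^{i_2} L^{i_3} R^{i_4} ⋯` for `l = [i_1, …, i_n]`. -/
def altProd (L R : Module.End K V) : List ℕ → Module.End K V
  | [] => 1
  | k :: l => L ^ k * altProd R L l

/-- The sequences `i_1, …, i_n` of integers with `n` even, `0 ≤ i_1 < ⋯ < i_n ≤ d` and
`i = ∑_{h=1}^n (-1)^h i_h` (the list `l` is indexed from `0`, so `l[h]` is `i_{h+1}`). -/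
def indexSeqs (d i : ℕ) : Set (List ℕ) :=
  {l | Even l.length ∧ l.Pairwise (· < ·) ∧ (∀ k ∈ l, k ≤ d) ∧
    (i : ℤ) = ∑ h : Fin l.length, (-1 : ℤ) ^ ((h : ℕ) + 1) * (l.get h : ℤ)}

end TDPair

end

/-! Write A = R + a k and A* = L + a* k⁻¹, where k is the scalar q^(2i-d) on U_i. Conjugation by k
scales R by q² and L by q⁻², so each tridiagonal relation splits into weight components. The extreme
component in which three R's meet one L is the cubic q-Serre relation for R, L, because the other
terms of that weight cancel (`qSerre_of_relation`); the roles of R and L can be exchanged.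

The cubic relation implies higher ones: for fixed n and m, the products X^s Y^n X^(m-s) satisfy so
many linear relations that any 2n+1 of them span the rest (`QSerre.sum_eq_zero`,
`mem_of_isRelation`). Rewriting with these, every alternating word in L and R becomes a combination
of words whose exponents have no a ≥ b < c (`altProd_mem_span_valleyFree`). Such a word either has
strictly increasing exponents or ends in L^x R^y with y ≤ x. On U_0 that ending gives 0 when y < x;
when y = x it is L^x R^x, which can be stripped if it acts on the vector as a scalar.

The same relations show that the maps L^j R^j commute on U_0 (`quadruple_symm`), so they have a
common eigenvector x there. By irreducibility the even words applied to x span V, hence so do the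
increasing ones. Only the empty increasing word has degree 0, so U_0 is the line through x. Thus v
is itself a common eigenvector, and sorting the increasing words by degree gives the spanning sets.
The count is Pascal's rule, by removal of the largest exponent. -/

namespace TDPair

/-! ### Higher-order q-Serre relations -/

section Serre

open Polynomial

variable {K E : Type*} [Field K] [Ring E] [Algebra K E]

/-- `T` is annihilated by the product of the operators `S ↦ X S - c p ^ k S X` for `k < n`. -/
def QAnn (X : E) (p c : K) : ℕ → E → Prop
  | 0, T => T = 0
  | n + 1, T => QAnn X p c n (X * T - (c * p ^ n) • (T * X))

theorem QAnn.zero (X : E) (p c : K) (n : ℕ) : QAnn X p c n (0 : E) := by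
  induction n with
  | zero => rfl
  | succ n ih => simpa [QAnn] using ih

theorem QAnn.add {X : E} {p c : K} {n : ℕ} {S T : E} (hS : QAnn X p c n S)
    (hT : QAnn X p c n T) : QAnn X p c n (S + T) := by
  induction n generalizing S T with
  | zero =>
    simp only [QAnn] at *
    rw [hS, hT, add_zero]
  | succ n ih =>
    have h := ih hS hT
    simp only [QAnn]
    convert h using 1
    simp only [mul_add, add_mul, smul_add]
    abel

theorem QAnn.smul {X : E} {p c : K} {n : ℕ} {S : E} (x : K) (hS : QAnn X p c n S) :
    QAnn X p c n (x • S) := by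
  induction n generalizing S with
  | zero =>
    simp only [QAnn] at *
    rw [hS, smul_zero]
  | succ n ih =>
    have h := ih hS
    simp only [QAnn]
    convert h using 1
    simp only [mul_smul_comm, smul_mul_assoc, smul_sub, smul_comm x]

/-- A twisted Leibniz rule: X(ST) - c e p^(m+n) (ST)X = (XS - c p^m SX) T + c p^m S (XT - e p^n TX).
Each summand has one factor fewer to kill, so induction on m + n applies. -/
theorem QAnn.mul {X : E} {p c e : K} {m n : ℕ} {S T : E} (hS : QAnn X p c m S)
    (hT : QAnn X p e n T) : QAnn X p (c * e) (m + n - 1) (S * T) := by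
  obtain ⟨N, hN⟩ : ∃ N, m + n = N := ⟨_, rfl⟩
  induction N generalizing m n S T with
  | zero =>
    obtain ⟨rfl, rfl⟩ : m = 0 ∧ n = 0 := by omega
    simp only [QAnn] at hS
    simpa [hS] using QAnn.zero X p (c * e) _
  | succ N ih =>
    cases m with
    | zero =>
      simp only [QAnn] at hS
      simpa [hS] using QAnn.zero X p (c * e) _
    | succ m =>
    cases n with
    | zero =>
      simp only [QAnn] at hT
      simpa [hT] using QAnn.zero X p (c * e) _
    | succ n =>
      have h1 := ih (m := m) (n := n + 1) hS hT (by omega)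
      have h2 := (ih (m := m + 1) (n := n) hS hT (by omega)).smul (c * p ^ m)
      rw [show m + (n + 1) - 1 = m + n by omega] at h1
      rw [show m + 1 + n - 1 = m + n by omega] at h2
      rw [show m + 1 + (n + 1) - 1 = m + n + 1 by omega]
      have h := h1.add h2
      simp only [QAnn]
      convert h using 1
      simp only [sub_mul, mul_sub, smul_sub, smul_mul_assoc, mul_smul_comm, smul_smul, mul_assoc]
      rw [show c * (p ^ m * (e * p ^ n)) = c * (e * p ^ (m + n)) by ring]
      abel

/-- The cubic `q`-Serre relation. -/
def QSerre (q : K) (X Y : E) : Prop :=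
  X ^ 3 * Y - (q ^ 2 + q ^ (-2 : ℤ) + 1) • (X ^ 2 * Y * X)
    + (q ^ 2 + q ^ (-2 : ℤ) + 1) • (X * Y * X ^ 2) - Y * X ^ 3 = 0

theorem QSerre.qAnn {q : K} (hq : q ≠ 0) {X Y : E} (h : QSerre q X Y) :
    QAnn X (q ^ 2) (q ^ (-2 : ℤ)) 3 Y := by
  simp only [QAnn]
  have e0 : q ^ (-2 : ℤ) * (q ^ 2) ^ 1 = 1 := by
    rw [zpow_neg]; field_simp
  have e1 : q ^ (-2 : ℤ) * (q ^ 2) ^ 2 = q ^ 2 := by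
    rw [pow_two (q ^ 2), ← mul_assoc]; rw [pow_one] at e0; rw [e0, one_mul]
  rw [e0, e1, pow_zero, mul_one]
  unfold QSerre at h
  rw [pow_one] at e0
  rw [← h]
  simp only [mul_sub, sub_mul, smul_sub, smul_mul_assoc, mul_smul_comm, smul_smul, pow_succ, pow_zero,
    one_mul, one_smul, add_smul, mul_assoc] at e0 ⊢
  rw [e0]
  simp only [one_smul]
  abel

/-- The higher order `q`-Serre relations. -/
theorem QSerre.qAnn_pow {q : K} (hq : q ≠ 0) {X Y : E} (h : QSerre q X Y) (n : ℕ) :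
    QAnn X (q ^ 2) (q ^ (-(2 * n) : ℤ)) (2 * n + 1) (Y ^ n) := by
  induction n with
  | zero => simp [QAnn]
  | succ n ih =>
    have := ih.mul (h.qAnn hq)
    rw [← zpow_add₀ hq] at this
    rw [pow_succ Y, show (-(2 * (n + 1 : ℕ)) : ℤ) = -(2 * n) + -2 by push_cast; ring]
    exact this

/-- The value of the homogenization of degree `m` of `h` at left and right multiplication by `X`,
applied to `T`. -/
def homEval (X : E) (m : ℕ) (h : K[X]) (T : E) : E :=
  ∑ s ∈ Finset.range (m + 1), h.coeff s • (X ^ s * T * X ^ (m - s))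

theorem homEval_X_sub_C_mul (X : E) (m : ℕ) (g : K[X]) (hg : g.natDegree ≤ m) (x : K) (T : E) :
    homEval X (m + 1) ((Polynomial.X - C x) * g) T = homEval X m g (X * T - x • (T * X)) := by
  have hlast : g.coeff (m + 1) = 0 := coeff_eq_zero_of_natDegree_lt (by omega)
  have h1 : ∑ s ∈ Finset.range (m + 1 + 1), (Polynomial.X * g).coeff s • (X ^ s * T * X ^ (m + 1 - s))
      = ∑ s ∈ Finset.range (m + 1), g.coeff s • (X ^ s * (X * T) * X ^ (m - s)) := by
    rw [Finset.sum_range_succ']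
    simp [coeff_X_mul, pow_succ, mul_assoc]
  have h2 : ∑ s ∈ Finset.range (m + 1 + 1), (C x * g).coeff s • (X ^ s * T * X ^ (m + 1 - s))
      = ∑ s ∈ Finset.range (m + 1), g.coeff s • (X ^ s * (x • (T * X)) * X ^ (m - s)) := by
    rw [Finset.sum_range_succ]
    simp only [coeff_C_mul, hlast, mul_zero, zero_smul, add_zero]
    refine Finset.sum_congr rfl fun s hs => ?_
    rw [Finset.mem_range] at hs
    rw [show m + 1 - s = m - s + 1 by omega, pow_succ']
    simp [mul_assoc, smul_smul, mul_comm]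
  simp only [homEval, sub_mul, coeff_sub, sub_smul, Finset.sum_sub_distrib, h1, h2, mul_sub, smul_sub]

/-- Each root of `h` splits off a linear factor, which acts as one of the operators annihilating
`T`. Injectivity keeps the remaining roots on the cofactor. -/
theorem QAnn.homEval_eq_zero {X : E} {p c : K} {n : ℕ} {T : E} (hT : QAnn X p c n T)
    (hinj : ∀ i j : ℕ, c * p ^ i = c * p ^ j → i = j) {m : ℕ} {h : K[X]}
    (hm : h.natDegree ≤ m) (hroot : ∀ k < n, h.IsRoot (c * p ^ k)) : homEval X m h T = 0 := by
  induction n generalizing m h T with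
  | zero =>
    simp only [QAnn] at hT
    simp [homEval, hT]
  | succ n ih =>
    obtain rfl | h0 := eq_or_ne h 0
    · simp [homEval]
    obtain ⟨g, rfl⟩ := dvd_iff_isRoot.mpr (hroot n (by omega))
    have hg : g ≠ 0 := right_ne_zero_of_mul h0
    rw [natDegree_mul (X_sub_C_ne_zero _) hg, natDegree_X_sub_C] at hm
    obtain ⟨m, rfl⟩ : ∃ m', m = m' + 1 := ⟨m - 1, by omega⟩
    rw [homEval_X_sub_C_mul X m g (by omega)]
    refine ih hT (by omega) fun k hk => ?_
    have hk' := hroot k (by omega)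
    rw [root_mul] at hk'
    refine hk'.resolve_left fun h' => ?_
    rw [root_X_sub_C] at h'
    have := hinj _ _ h'
    omega

theorem QAnn.sum_eq_zero {X : E} {p c : K} {n : ℕ} {T : E} (hT : QAnn X p c n T)
    (hinj : ∀ i j : ℕ, c * p ^ i = c * p ^ j → i = j) {m : ℕ} {w : ℕ → K}
    (hw : ∀ k < n, ∑ s ∈ Finset.range (m + 1), w s * (c * p ^ k) ^ s = 0) :
    ∑ s ∈ Finset.range (m + 1), w s • (X ^ s * T * X ^ (m - s)) = 0 := by
  have hc : ∀ s ∈ Finset.range (m + 1),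
      (∑ s ∈ Finset.range (m + 1), monomial s (w s)).coeff s = w s := by
    intro s hs
    simp only [finsetSum_coeff, coeff_monomial]
    rw [Finset.sum_ite_eq' (Finset.range (m + 1)) s, if_pos hs]
  have := hT.homEval_eq_zero hinj (m := m) (h := ∑ s ∈ Finset.range (m + 1), monomial s (w s))
    (natDegree_sum_le_of_forall_le _ _ fun s hs => (natDegree_monomial_le _).trans
      (by rw [Finset.mem_range] at hs; omega))
    (fun k hk => by simpa [IsRoot, eval_finsetSum] using hw k hk)
  rw [← this, homEval]
  exact Finset.sum_congr rfl fun s hs => by rw [hc s hs]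

/-- The weights `w` on `0, …, m` are orthogonal to the points `q ^ (2 * k)`, `-n ≤ k ≤ n`. -/
def IsRelation (q : K) (n m : ℕ) (w : ℕ → K) : Prop :=
  ∀ k : ℤ, |k| ≤ n → ∑ s ∈ Finset.range (m + 1), w s * q ^ (2 * k * s) = 0

theorem IsRelation.reflect {q : K} (hq0 : q ≠ 0) {n m : ℕ} {w : ℕ → K} (h : IsRelation q n m w) :
    IsRelation q n m (fun s => w (m - s)) := by
  intro k hk
  have := h (-k) (by rwa [abs_neg])
  rw [← Finset.sum_range_reflect]
  have h2 := congrArg (fun x => q ^ (2 * k * m) * x) this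
  simp only [Finset.mul_sum, mul_zero] at h2
  rw [← h2]
  refine Finset.sum_congr rfl fun s hs => ?_
  rw [Finset.mem_range] at hs
  simp only [show m + 1 - 1 - s = m - s by omega, show m - (m - s) = s by omega]
  rw [mul_left_comm, ← zpow_add₀ hq0]
  congr 2
  push_cast [show s ≤ m by omega]
  ring

theorem pow_injective_of_not_root {q : K} (hq0 : q ≠ 0) (hq : ∀ n : ℕ, 0 < n → q ^ n ≠ 1) :
    Function.Injective fun k : ℤ => q ^ k := by
  intro i j hij
  by_contra hne
  simp only at hij
  have h1 : q ^ (i - j) = 1 := by rw [zpow_sub₀ hq0, hij, div_self (zpow_ne_zero _ hq0)]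
  obtain ⟨n, hn | hn⟩ := Int.eq_nat_or_neg (i - j)
  · rw [hn, zpow_natCast] at h1
    exact hq n (by omega) h1
  · rw [hn, zpow_neg, inv_eq_one, zpow_natCast] at h1
    exact hq n (by omega) h1

theorem QSerre.sum_eq_zero {q : K} (hq0 : q ≠ 0) (hq : ∀ n : ℕ, 0 < n → q ^ n ≠ 1) {X Y : E}
    (h : QSerre q X Y) {n m : ℕ} {w : ℕ → K} (hw : IsRelation q n m w) :
    ∑ s ∈ Finset.range (m + 1), w s • (X ^ s * Y ^ n * X ^ (m - s)) = 0 := by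
  have key : ∀ k : ℕ, q ^ (-(2 * n) : ℤ) * (q ^ 2) ^ k = q ^ (2 * ((k : ℤ) - n)) := by
    intro k
    rw [← pow_mul, ← zpow_natCast, ← zpow_add₀ hq0]
    congr 1
    push_cast
    ring
  refine (h.qAnn_pow hq0 n).sum_eq_zero ?_ ?_
  · intro i j hij
    rw [key, key] at hij
    have := pow_injective_of_not_root hq0 hq hij
    omega
  · intro k hk
    rw [← hw ((k : ℤ) - n) (by rw [abs_le]; omega)]
    refine Finset.sum_congr rfl fun s _ => ?_
    rw [key, ← zpow_natCast (q ^ _), ← zpow_mul]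

theorem QSerre.sum_reflect_eq_zero {q : K} (hq0 : q ≠ 0) (hq : ∀ n : ℕ, 0 < n → q ^ n ≠ 1)
    {X Y : E} (h : QSerre q X Y) {n m : ℕ} {w : ℕ → K} (hw : IsRelation q n m w) :
    ∑ s ∈ Finset.range (m + 1), w s • (X ^ (m - s) * Y ^ n * X ^ s) = 0 := by
  have := h.sum_eq_zero hq0 hq (hw.reflect hq0)
  rw [← Finset.sum_range_reflect] at this
  rw [← this]
  refine Finset.sum_congr rfl fun s hs => ?_
  rw [Finset.mem_range] at hs
  rw [show m + 1 - 1 - s = m - s by omega, show m - (m - s) = s by omega]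

/-- Lagrange interpolation at the 2n+1 distinct nodes q^(2s) is exact on monomials of degree at most
2n. -/
theorem exists_weights {q : K} (hq0 : q ≠ 0) (hq : ∀ n : ℕ, 0 < n → q ^ n ≠ 1) {n : ℕ}
    {S : Finset ℕ} (hS : S.card = 2 * n + 1) (r : ℕ) :
    ∃ w : ℕ → K, ∀ k : ℤ, |k| ≤ n → ∑ s ∈ S, w s * q ^ (2 * k * s) = q ^ (2 * k * r) := by
  classical
  let y : ℕ → K := fun s => q ^ (2 * (s : ℤ))
  have hy : Set.InjOn y S := by
    intro i _ j _ hij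
    have := pow_injective_of_not_root hq0 hq hij
    omega
  -- The power of q shifts the exponent range 0, …, 2n of the monomials to -n, …, n.
  refine ⟨fun s => q ^ (2 * (n : ℤ) * (s - r)) * (Lagrange.basis S y s).eval (y r), fun k hk => ?_⟩
  rw [abs_le] at hk
  obtain ⟨j, hj⟩ : ∃ j : ℕ, (j : ℤ) = k + n := ⟨(k + n).toNat, by omega⟩
  have hI := Lagrange.eq_interpolate (s := S) (v := y) (f := (X ^ j : K[X])) hy
    (by rw [degree_X_pow, hS]; exact_mod_cast (by omega : j < 2 * n + 1))
  have hE := congrArg (eval (y r)) hI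
  simp only [Lagrange.interpolate_apply, eval_finsetSum, eval_mul, eval_C, eval_pow, eval_X] at hE
  have hy' : ∀ s, y s ^ j = q ^ (2 * (s : ℤ) * (k + n)) := by
    intro s
    rw [← hj, zpow_mul, zpow_natCast]
  simp only [hy'] at hE
  have h2 := congrArg (fun x => q ^ (-(2 * (n : ℤ) * r)) * x) hE
  simp only [Finset.mul_sum, ← zpow_add₀ hq0] at h2
  rw [show 2 * k * (r : ℤ) = -(2 * (n : ℤ) * r) + 2 * r * (k + n) by ring, h2]
  refine Finset.sum_congr rfl fun s _ => ?_
  rw [← mul_assoc, ← zpow_add₀ hq0, mul_right_comm, ← zpow_add₀ hq0]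
  congr 2
  ring

/-- A family satisfying all relations is determined by any `2 * n + 1` of its members. -/
theorem mem_of_isRelation {q : K} (hq0 : q ≠ 0) (hq : ∀ n : ℕ, 0 < n → q ^ n ≠ 1)
    {M : Type*} [AddCommGroup M] [Module K M] {N : Submodule K M} {n m : ℕ} {f : ℕ → M}
    (hf : ∀ w : ℕ → K, IsRelation q n m w → ∑ s ∈ Finset.range (m + 1), w s • f s = 0)
    {S : Finset ℕ} (hSm : S ⊆ Finset.range (m + 1)) (hS : S.card = 2 * n + 1)
    (hN : ∀ s ∈ S, f s ∈ N) {r : ℕ} (hr : r ≤ m) : f r ∈ N := by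
  classical
  obtain ⟨w, hw⟩ := exists_weights hq0 hq hS r
  have hr' : r ∈ Finset.range (m + 1) := Finset.mem_range.mpr (by omega)
  have h := hf (fun s => (if s = r then 1 else 0) - if s ∈ S then w s else 0) (by
    intro k hk
    simp only [sub_mul, Finset.sum_sub_distrib, ite_mul, one_mul, zero_mul, Finset.sum_ite_eq',
      hr', if_true, ← Finset.sum_filter, Finset.filter_mem_eq_inter,
      Finset.inter_eq_right.mpr hSm, hw k hk, sub_self])
  simp only [sub_smul, Finset.sum_sub_distrib, ite_smul, one_smul, zero_smul, Finset.sum_ite_eq',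
      hr', if_true, ← Finset.sum_filter, Finset.filter_mem_eq_inter,
      Finset.inter_eq_right.mpr hSm] at h
  rw [sub_eq_zero.mp h]
  exact N.sum_mem fun s hs => N.smul_mem _ (hN s hs)

end Serre

/-! ### Rewriting alternating words -/

section Words

variable {K V : Type*} [Field K] [AddCommGroup V] [Module K V]

theorem altProd_append (L R : Module.End K V) (p l : List ℕ) :
    altProd L R (p ++ l) =
      altProd L R p * if Even p.length then altProd L R l else altProd R L l := by
  induction p generalizing L R with
  | nil => simp [altProd]
  | cons k p ih =>
    simp only [List.cons_append, altProd, ih, List.length_cons, Nat.even_add_one, mul_assoc]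
    by_cases h : Even p.length <;> simp [h]

/-- With `b` and `a + c` fixed, 2b+1 of the words determine all others. The chosen ones have outer
exponents a' < b (b of them) or c' ≤ b (b+1 of them), so none has a valley at this place; the two
ranges are disjoint because a + c > 2b. -/
theorem altProd_mem_of_exchange {q : K} (hq0 : q ≠ 0) (hq : ∀ n : ℕ, 0 < n → q ^ n ≠ 1)
    {L R : Module.End K V} (hLR : QSerre q L R) (hRL : QSerre q R L)
    {N : Submodule K (Module.End K V)} {p t : List ℕ} {a b c : ℕ} (hab : b ≤ a) (hbc : b < c)
    (H : ∀ a' c', a' + c' = a + c → a' < b ∨ c' ≤ b → altProd L R (p ++ a' :: b :: c' :: t) ∈ N) :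
    altProd L R (p ++ a :: b :: c :: t) ∈ N := by
  have hmem : ∀ s ∈ Finset.range b ∪ Finset.Icc (a + c - b) (a + c),
      s ≤ a + c ∧ (s < b ∨ a + c - s ≤ b) := by
    intro s hs
    simp only [Finset.mem_union, Finset.mem_range, Finset.mem_Icc] at hs
    omega
  have := mem_of_isRelation hq0 hq (N := N) (n := b) (m := a + c)
    (f := fun s => altProd L R (p ++ s :: b :: (a + c - s) :: t)) ?_
    (S := Finset.range b ∪ Finset.Icc (a + c - b) (a + c)) ?_ ?_ ?_ (r := a) (by omega)
  · simpa using this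
  · intro w hw
    simp only [altProd_append, altProd]
    split_ifs with hp
    · have h := congrArg (fun x => altProd L R p * x * altProd R L t) (hLR.sum_eq_zero hq0 hq hw)
      simpa only [Finset.mul_sum, Finset.sum_mul, mul_smul_comm, smul_mul_assoc, mul_assoc,
        mul_zero, zero_mul] using h
    · have h := congrArg (fun x => altProd L R p * x * altProd L R t) (hRL.sum_eq_zero hq0 hq hw)
      simpa only [Finset.mul_sum, Finset.sum_mul, mul_smul_comm, smul_mul_assoc, mul_assoc,
        mul_zero, zero_mul] using h
  · intro s hs
    have := hmem s hs
    rw [Finset.mem_range]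
    omega
  · rw [Finset.card_union_of_disjoint, Finset.card_range, Nat.card_Icc]
    · omega
    · rw [Finset.disjoint_left]
      intro s hs
      simp only [Finset.mem_range, Finset.mem_Icc] at hs ⊢
      omega
  · intro s hs
    have := hmem s hs
    exact H s (a + c - s) (by omega) this.2

/-- No three consecutive entries `a, b, c` satisfy `a ≥ b < c`. -/
def ValleyFree (l : List ℕ) : Prop :=
  ∀ p a b c t, l = p ++ a :: b :: c :: t → b ≤ a → c ≤ b

theorem ValleyFree.tail {k : ℕ} {l : List ℕ} (h : ValleyFree (k :: l)) : ValleyFree l :=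
  fun p a b c t hl => h (k :: p) a b c t (by rw [hl, List.cons_append])

theorem ValleyFree.of_append {l l' : List ℕ} (h : ValleyFree (l ++ l')) : ValleyFree l :=
  fun p a b c t hl => h p a b c (t ++ l') (by simp [hl])

theorem ValleyFree.pairwise_or {l : List ℕ} (h : ValleyFree l) :
    l.Pairwise (· < ·) ∨ ∃ l' x y, l = l' ++ [x, y] ∧ y ≤ x := by
  induction l with
  | nil => simp
  | cons a l ih =>
    obtain hl | ⟨l', x, y, rfl, hxy⟩ := ih h.tail
    · match l, hl, h with
      | [], _, _ => simp
      | [b], _, _ =>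
        by_cases hab : a < b
        · simp [hab]
        · exact Or.inr ⟨[], a, b, rfl, not_lt.mp hab⟩
      | b :: c :: t, hl, h =>
        have hbc : b < c := (List.pairwise_cons.mp hl).1 c (by simp)
        have hab : a < b := by
          by_contra hab
          have := h [] a b c t rfl (not_lt.mp hab)
          omega
        refine Or.inl (List.pairwise_cons.mpr ⟨fun z hz => ?_, hl⟩)
        obtain rfl | hz := List.mem_cons.mp hz
        · exact hab
        · exact hab.trans ((List.pairwise_cons.mp hl).1 z hz)
    · exact Or.inr ⟨a :: l', x, y, rfl, hxy⟩

/-- The sum of the squares of the entries. -/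
def sumSq (l : List ℕ) : ℕ := (l.map (· ^ 2)).sum

/-- The sum of the entries, weighted by their positions. -/
def posSum : List ℕ → ℕ
  | [] => 0
  | _ :: l => l.sum + posSum l

theorem sumSq_le (l : List ℕ) : sumSq l ≤ l.sum ^ 2 := by
  induction l with
  | nil => simp [sumSq]
  | cons a l ih =>
    simp only [sumSq, List.map_cons, List.sum_cons] at *
    nlinarith [Nat.zero_le (a * l.sum)]

theorem posSum_append (p l : List ℕ) : posSum (p ++ l) = posSum p + p.length * l.sum + posSum l := by
  induction p with
  | nil => simp [posSum]
  | cons a p ih =>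
    simp only [List.cons_append, posSum, List.sum_append, ih, List.length_cons]
    ring

/-- An exchange may create valleys elsewhere, so termination needs a global measure: the sum of
squares grows, bounded by the square of the fixed sum, and ties are broken by `posSum`. -/
theorem altProd_mem_span_valleyFree {q : K} (hq0 : q ≠ 0) (hq : ∀ n : ℕ, 0 < n → q ^ n ≠ 1)
    {L R : Module.End K V} (hLR : QSerre q L R) (hRL : QSerre q R L) (l : List ℕ) :
    altProd L R l ∈ Submodule.span K
      (altProd L R '' {l' | ValleyFree l' ∧ l'.length = l.length}) := by
  by_cases h : ValleyFree l
  · exact Submodule.subset_span ⟨l, ⟨h, rfl⟩, rfl⟩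
  · unfold ValleyFree at h
    push Not at h
    obtain ⟨p, a, b, c, t, hl, hab, hbc⟩ := h
    have hlen : ∀ a' c', l.length = (p ++ a' :: b :: c' :: t).length := by simp [hl]
    have key : ∀ a' c', a' + c' = a + c → a' < b ∨ c' ≤ b →
        altProd L R (p ++ a' :: b :: c' :: t) ∈ Submodule.span K
          (altProd L R '' {l' | ValleyFree l' ∧ l'.length = l.length}) := by
      intro a' c' hac h'
      rw [hlen a' c']
      exact altProd_mem_span_valleyFree hq0 hq hLR hRL (p ++ a' :: b :: c' :: t)
    have := altProd_mem_of_exchange hq0 hq hLR hRL (p := p) (t := t) hab hbc key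
    rwa [← hl] at this
termination_by (l.sum ^ 2 - sumSq l, posSum l)
decreasing_by
  have hs : (p ++ a' :: b :: c' :: t).sum = l.sum := by
    simp only [hl, List.sum_append, List.sum_cons]
    omega
  have hb := sumSq_le (p ++ a' :: b :: c' :: t)
  rw [hs] at hb ⊢
  have e1 : sumSq (p ++ a' :: b :: c' :: t) = sumSq p + a' ^ 2 + b ^ 2 + c' ^ 2 + sumSq t := by
    simp [sumSq]; ring
  have e2 : sumSq l = sumSq p + a ^ 2 + b ^ 2 + c ^ 2 + sumSq t := by
    simp [sumSq, hl]; ring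
  -- The outer exponents move apart with their sum fixed, which raises the sum of squares. The only
  -- tie is the swap a' = c, c' = a, which brings the larger exponent forward.
  have hcmp : sumSq l < sumSq (p ++ a' :: b :: c' :: t) ∨
      sumSq l = sumSq (p ++ a' :: b :: c' :: t) ∧ c' < c := by
    rw [e1, e2]
    by_cases hlt : a' < b
    · left
      obtain ⟨e, rfl⟩ : ∃ e, a = a' + e := ⟨a - a', by omega⟩
      obtain rfl : c' = c + e := by omega
      have : 0 < e := by omega
      nlinarith [mul_pos this (by omega : 0 < c - a'), Nat.sub_add_cancel (by omega : a' ≤ c)]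
    · have hc' : c' ≤ b := by omega
      obtain ⟨e, rfl⟩ : ∃ e, c = c' + e := ⟨c - c', by omega⟩
      obtain rfl : a' = a + e := by omega
      obtain ⟨f, rfl⟩ : ∃ f, a = c' + f := ⟨a - c', by omega⟩
      have : 0 < e := by omega
      obtain rfl | hf := Nat.eq_zero_or_pos f
      · right
        exact ⟨by ring, by omega⟩
      · left
        nlinarith [mul_pos this hf]
  obtain h1 | ⟨h1, h2⟩ := hcmp
  · exact Prod.Lex.left _ _ (by omega)
  · rw [h1]
    refine Prod.Lex.right _ ?_
    rw [hl, posSum_append, posSum_append]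
    simp only [posSum, List.sum_cons]
    have : a' + (b + (c' + t.sum)) = a + (b + (c + t.sum)) := by omega
    rw [this]
    omega

end Words

/-! ### From tridiagonal relations to q-Serre relations -/

section Components

variable {K E : Type*} [Field K] [Ring E] [Algebra K E]

theorem eq_zero_of_sum_eigenvectors {M ι : Type*} [AddCommGroup M] [Module K M]
    (f : Module.End K M) (s : Finset ι) (x : ι → M) (μ : ι → K) (hμ : Set.InjOn μ s)
    (hx : ∀ i ∈ s, f (x i) = μ i • x i) (hsum : ∑ i ∈ s, x i = 0) : ∀ i ∈ s, x i = 0 := by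
  classical
  induction s using Finset.induction_on generalizing x with
  | empty => simp
  | insert j s hj ih =>
    have hs : ∀ i ∈ s, x i = 0 := by
      intro i hi
      have hne : μ i - μ j ≠ 0 := by
        refine sub_ne_zero.mpr fun h => ?_
        have := hμ (by simp [hi]) (by simp) h
        exact hj (this ▸ hi)
      have := ih (fun i => (μ i - μ j) • x i) (hμ.mono (by simp)) (fun i hi => by
        rw [map_smul, hx i (by simp [hi]), smul_comm]) (by
        have h1 := congrArg f hsum
        rw [map_sum, map_zero, Finset.sum_congr rfl hx, Finset.sum_insert hj] at h1
        rw [Finset.sum_insert hj] at hsum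
        simp only [sub_smul, Finset.sum_sub_distrib, ← Finset.smul_sum]
        rw [← sub_eq_zero.mpr h1.symm, eq_neg_of_add_eq_zero_right hsum, smul_neg]
        simp only [zero_sub, sub_neg_eq_add, neg_add_rev]
        abel_nf
        simp [eq_neg_of_add_eq_zero_left h1]) i hi
      exact (smul_eq_zero.mp this).resolve_left hne
    intro i hi
    obtain rfl | hi := Finset.mem_insert.mp hi
    · rwa [Finset.sum_insert hj, Finset.sum_eq_zero hs, add_zero] at hsum
    · exact hs i hi

/-- `x` is multiplied by `t` under conjugation by `k`, with inverse `k'`. -/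
def HasWeight (k k' : E) (t : K) (x : E) : Prop := k * x * k' = t • x

theorem HasWeight.mul {k k' : E} (hk : k' * k = 1) {s t : K} {x y : E}
    (hx : HasWeight k k' s x) (hy : HasWeight k k' t y) : HasWeight k k' (s * t) (x * y) := by
  unfold HasWeight at *
  calc k * (x * y) * k' = (k * x * k') * (k * y * k') := by
        simp only [mul_assoc]
        rw [← mul_assoc k' k, hk, one_mul]
    _ = _ := by rw [hx, hy, smul_mul_smul_comm]

theorem HasWeight.add {k k' : E} {t : K} {x y : E} (hx : HasWeight k k' t x)
    (hy : HasWeight k k' t y) : HasWeight k k' t (x + y) := by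
  unfold HasWeight at *
  rw [mul_add, add_mul, hx, hy, smul_add]

theorem HasWeight.smul {k k' : E} {t : K} {x : E} (c : K) (hx : HasWeight k k' t x) :
    HasWeight k k' t (c • x) := by
  unfold HasWeight at *
  rw [mul_smul_comm, smul_mul_assoc, hx, smul_comm]

theorem HasWeight.sub {k k' : E} {t : K} {x y : E} (hx : HasWeight k k' t x)
    (hy : HasWeight k k' t y) : HasWeight k k' t (x - y) := by
  unfold HasWeight at *
  rw [mul_sub, sub_mul, hx, hy, smul_sub]

/-- The polarization of the cubic `q`-Serre polynomial. -/
def serrePolar (q : K) (x y z w : E) : E :=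
  x * y * z * w - (q ^ 2 + q ^ (-2 : ℤ) + 1) • (x * y * w * z)
    + (q ^ 2 + q ^ (-2 : ℤ) + 1) • (x * w * y * z) - w * x * y * z

theorem HasWeight.serrePolar {k k' : E} (hk : k' * k = 1) (q : K) {r s t u v : K} {x y z w : E}
    (hx : HasWeight k k' r x) (hy : HasWeight k k' s y) (hz : HasWeight k k' t z)
    (hw : HasWeight k k' u w) (hv : r * s * t * u = v) :
    HasWeight k k' v (serrePolar q x y z w) := by
  subst hv
  unfold TDPair.serrePolar
  refine HasWeight.sub (HasWeight.add (HasWeight.sub ?_ (HasWeight.smul _ ?_))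
    (HasWeight.smul _ ?_)) ?_
  · exact ((hx.mul hk hy).mul hk hz).mul hk hw
  · convert ((hx.mul hk hy).mul hk hw).mul hk hz using 1; ring
  · convert ((hx.mul hk hw).mul hk hy).mul hk hz using 1; ring
  · convert ((hw.mul hk hx).mul hk hy).mul hk hz using 1; ring

/-- Moving k and k' to the right turns every term into a scalar multiple of R², and the scalars sum
to zero. -/
theorem serrePolar_cancel {q : K} (hq0 : q ≠ 0) {R k k' : E} (hk : k * k' = 1) (hk' : k' * k = 1)
    (hR : k * R = q ^ 2 • (R * k)) :
    serrePolar q R R k k' + serrePolar q R k R k' + serrePolar q k R R k' = 0 := by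
  have hR' : k' * R = q ^ (-2 : ℤ) • (R * k') := by
    have h := congrArg (fun x => q ^ (-2 : ℤ) • (k' * x * k')) hR
    simp only [← mul_assoc, hk', one_mul, mul_smul_comm, smul_mul_assoc, smul_smul] at h
    rw [mul_assoc, hk, mul_one, ← zpow_natCast, ← zpow_add₀ hq0] at h
    simpa using h.symm
  simp only [serrePolar, mul_assoc, hR, hR', hk, hk', mul_smul_comm, smul_mul_assoc,
    mul_one, one_mul]
  match_scalars
  rw [zpow_neg]
  norm_cast
  field_simp
  ring

/-- Expanding multilinearly, a term has weight q^(2e), with e the number of R's minus the number of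
L's. Components of the distinct weights e = -1, …, 3 vanish separately; e = 2 consists of the Serre
polynomial and the terms removed by `serrePolar_cancel`. -/
theorem qSerre_of_relation {q : K} (hq0 : q ≠ 0) (hq : ∀ n : ℕ, 0 < n → q ^ n ≠ 1)
    {R L k k' : E} (hk : k * k' = 1) (hk' : k' * k = 1)
    (hR : k * R = q ^ 2 • (R * k)) (hL : k * L = q ^ (-2 : ℤ) • (L * k)) (a b : K)
    (h : serrePolar q (R + a • k) (R + a • k) (R + a • k) (L + b • k') = 0) : QSerre q R L := by
  have hRw : HasWeight k k' (q ^ 2) R := by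
    rw [HasWeight, hR, smul_mul_assoc, mul_assoc, hk, mul_one]
  have hLw : HasWeight k k' (q ^ (-2 : ℤ)) L := by
    rw [HasWeight, hL, smul_mul_assoc, mul_assoc, hk, mul_one]
  have hkw : HasWeight k k' (1 : K) (a • k) :=
    HasWeight.smul a (by rw [HasWeight, mul_assoc, hk, mul_one, one_smul])
  have hkw' : HasWeight k k' (1 : K) (b • k') :=
    HasWeight.smul b (by rw [HasWeight, hk, one_mul, one_smul])
  set D := a • k with hD
  set D' := b • k' with hD'
  -- Index i collects the terms of weight q^(2i-2).
  let x : ℕ → E := fun i => match i with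
    | 0 => serrePolar q D D D L
    | 1 => serrePolar q R D D L + serrePolar q D R D L + serrePolar q D D R L
            + serrePolar q D D D D'
    | 2 => serrePolar q R R D L + serrePolar q R D R L + serrePolar q D R R L
            + (serrePolar q R D D D' + serrePolar q D R D D' + serrePolar q D D R D')
    | 3 => serrePolar q R R R L
            + (serrePolar q R R D D' + serrePolar q R D R D' + serrePolar q D R R D')
    | _ => serrePolar q R R R D'
  have e2 : q ^ 2 * q ^ (-2 : ℤ) = 1 := by
    rw [zpow_neg]; norm_cast; field_simp
  have hx := eq_zero_of_sum_eigenvectors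
    (LinearMap.mulLeft K k ∘ₗ LinearMap.mulRight K k') (Finset.range 5) x
    (fun i => q ^ (2 * (i : ℤ) - 2)) (by
      intro i _ j _ hij
      have := pow_injective_of_not_root hq0 hq hij
      omega) (by
      have key : ∀ (t : K) y, HasWeight k k' t y →
          (LinearMap.mulLeft K k ∘ₗ LinearMap.mulRight K k') y = t • y := by
        intro t y hy
        rw [← hy]
        simp [mul_assoc]
      intro i hi
      apply key
      have hi5 : i < 5 := Finset.mem_range.mp hi
      interval_cases i
      · exact hkw.serrePolar hk' q hkw hkw hLw (by norm_num)
      · rw [show (2 * ((1 : ℕ) : ℤ) - 2) = 0 by norm_num, zpow_zero]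
        exact (((hRw.serrePolar hk' q hkw hkw hLw (by linear_combination e2)).add
          (hkw.serrePolar hk' q hRw hkw hLw (by linear_combination e2))).add
          (hkw.serrePolar hk' q hkw hRw hLw (by linear_combination e2))).add
          (hkw.serrePolar hk' q hkw hkw hkw' (by norm_num))
      · rw [show (2 * ((2 : ℕ) : ℤ) - 2) = (2 : ℕ) by norm_num, zpow_natCast]
        exact (((hRw.serrePolar hk' q hRw hkw hLw (by linear_combination q ^ 2 * e2)).add
          (hRw.serrePolar hk' q hkw hRw hLw (by linear_combination q ^ 2 * e2))).add
          (hkw.serrePolar hk' q hRw hRw hLw (by linear_combination q ^ 2 * e2))).add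
          (((hRw.serrePolar hk' q hkw hkw hkw' (by ring)).add
          (hkw.serrePolar hk' q hRw hkw hkw' (by ring))).add
          (hkw.serrePolar hk' q hkw hRw hkw' (by ring)))
      · rw [show (2 * ((3 : ℕ) : ℤ) - 2) = (4 : ℕ) by norm_num, zpow_natCast]
        exact (hRw.serrePolar hk' q hRw hRw hLw (by linear_combination q ^ 4 * e2)).add
          (((hRw.serrePolar hk' q hRw hkw hkw' (by ring)).add
          (hRw.serrePolar hk' q hkw hRw hkw' (by ring))).add
          (hkw.serrePolar hk' q hRw hRw hkw' (by ring)))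
      · rw [show (2 * ((4 : ℕ) : ℤ) - 2) = (6 : ℕ) by norm_num, zpow_natCast]
        exact hRw.serrePolar hk' q hRw hRw hkw' (by ring)) (by
      rw [← h]
      simp only [Finset.sum_range_succ, Finset.sum_range_zero, x, serrePolar, mul_add, add_mul,
        smul_add]
      abel) 3 (by simp)
  have hc : serrePolar q R R D D' + serrePolar q R D R D' + serrePolar q D R R D' = 0 := by
    have := congrArg (fun y => (a * b) • y) (serrePolar_cancel hq0 hk hk' hR)
    simp only [smul_zero] at this
    rw [← this]
    simp only [hD, hD', serrePolar, mul_smul_comm, smul_mul_assoc, smul_add, smul_sub, smul_smul]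
    module
  simp only [x, hc, add_zero] at hx
  rw [QSerre, ← hx, serrePolar]
  simp only [pow_succ, pow_zero, one_mul, mul_assoc]

theorem serrePolar_of_tridiagonalRelation {V : Type*} [AddCommGroup V] [Module K V] {q : K}
    {A B : Module.End K V} (h : TridiagonalRelation (q ^ 2 + q ^ (-2 : ℤ)) 0 0 A B) :
    serrePolar q A A A B = 0 := by
  rw [← h, serrePolar, Ring.lie_def]
  simp only [zero_smul, sub_zero, mul_add, mul_sub, add_mul, sub_mul, mul_smul_comm,
    smul_mul_assoc, add_smul, one_smul, pow_succ, pow_zero, one_mul, mul_assoc]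
  abel

end Components

/-! ### Words acting on a graded space -/

section Graded

variable {K V : Type*} [Field K] [AddCommGroup V] [Module K V]

/-- `T` maps the piece `G i` into the piece `G (i + e)`. -/
def Shifts (G : ℤ → Submodule K V) (e : ℤ) (T : Module.End K V) : Prop :=
  ∀ i, ∀ u ∈ G i, T u ∈ G (i + e)

theorem Shifts.one (G : ℤ → Submodule K V) : Shifts G 0 1 := fun i u hu => by simpa using hu

theorem Shifts.mul {G : ℤ → Submodule K V} {e f : ℤ} {S T : Module.End K V} (hS : Shifts G e S)
    (hT : Shifts G f T) : Shifts G (e + f) (S * T) := fun i u hu => by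
  have := hS _ _ (hT _ _ hu)
  rwa [add_assoc, add_comm f e] at this

theorem Shifts.pow {G : ℤ → Submodule K V} {e : ℤ} {T : Module.End K V} (hT : Shifts G e T)
    (n : ℕ) : Shifts G (n * e) (T ^ n) := by
  induction n with
  | zero => simpa using Shifts.one G
  | succ n ih =>
    rw [pow_succ]
    convert ih.mul hT using 1
    push_cast
    ring

/-- The alternating sum `-i_1 + i_2 - i_3 + ⋯`. -/
def altDeg : List ℕ → ℤ
  | [] => 0
  | k :: l => -k - altDeg l

theorem Shifts.altProd {G : ℤ → Submodule K V} {e : ℤ} {L R : Module.End K V}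
    (hL : Shifts G (-e) L) (hR : Shifts G e R) (l : List ℕ) :
    Shifts G (e * altDeg l) (altProd L R l) := by
  induction l generalizing e L R with
  | nil => simpa [TDPair.altProd, altDeg] using Shifts.one G
  | cons k l ih =>
    have := (hL.pow k).mul (ih (e := -e) (by rwa [neg_neg]) hL)
    simp only [TDPair.altProd, altDeg]
    convert this using 1
    ring

/-- A power above d shifts degrees by more than d, hence out of the range 0, …, d. -/
theorem altProd_apply_eq_zero {G : ℤ → Submodule K V} {d : ℕ}
    (hG : ∀ j : ℤ, j < 0 ∨ d < j → G j = ⊥) {e : ℤ} (he : |e| = 1) {L R : Module.End K V}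
    (hL : Shifts G (-e) L) (hR : Shifts G e R) {l : List ℕ} (hl : ∃ k ∈ l, d < k) {i : ℤ} {u : V}
    (hu : u ∈ G i) : altProd L R l u = 0 := by
  induction l generalizing e L R with
  | nil => simp at hl
  | cons k l ih =>
    simp only [altProd, Module.End.mul_apply]
    by_cases hk : d < k
    · have hw := Shifts.altProd (e := -e) (by rwa [neg_neg]) hL l i u hu
      have hw' := hL.pow k _ _ hw
      set j := i + -e * altDeg l
      by_cases hj : j < 0 ∨ d < j
      · rw [hG j hj, Submodule.mem_bot] at hw
        rw [hw, map_zero]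
      · rw [hG _ ?_, Submodule.mem_bot] at hw'
        · exact hw'
        · obtain rfl | rfl := (abs_eq zero_le_one).mp he <;> omega
    · obtain ⟨k', hk', h⟩ := hl
      have hk'' : k' ∈ l := by
        obtain rfl | h' := List.mem_cons.mp hk'
        · exact absurd h hk
        · exact h'
      rw [ih (e := -e) (by rwa [abs_neg]) (by rwa [neg_neg]) hL ⟨k', hk'', h⟩, map_zero]

/-- In even length the entries pair into positive differences. The odd case is there to carry the
induction. -/
theorem altDeg_nonneg_and_pos {l : List ℕ} (hl : l.Pairwise (· < ·)) :
    (Even l.length → 0 ≤ altDeg l ∧ (l ≠ [] → 0 < altDeg l)) ∧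
      (Odd l.length → ∀ k ∈ l.head?, altDeg l ≤ -k) := by
  induction l with
  | nil => simp [altDeg]
  | cons a l ih =>
    obtain ⟨h1, h2⟩ := ih hl.of_cons
    refine ⟨fun he => ?_, fun ho => ?_⟩
    · rw [List.length_cons, Nat.even_add_one, Nat.not_even_iff_odd] at he
      match l, hl, he, h2 with
      | b :: t, hl, he, h2 =>
        have h := h2 he b (by simp)
        have hab : a < b := (List.pairwise_cons.mp hl).1 b (by simp)
        rw [altDeg]
        exact ⟨by omega, fun _ => by omega⟩
    · rw [List.length_cons, Nat.odd_add_one, Nat.not_odd_iff_even] at ho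
      have := (h1 ho).1
      simp only [List.head?_cons, Option.mem_def, Option.some.injEq, forall_eq', altDeg]
      omega

theorem eq_nil_of_altDeg_eq_zero {l : List ℕ} (hl : l.Pairwise (· < ·)) (he : Even l.length)
    (h : altDeg l = 0) : l = [] := by
  by_contra hne
  exact ((altDeg_nonneg_and_pos hl).1 he).2 hne |>.ne' h

/-- As functions of b, both sides satisfy the relations of order c, so agreement at 2c+1 values of b
suffices: b ≤ c, by induction and symmetry, and b > m - c, where both sides pass through negative
degree. The case m = b + c says that L^b R^b and L^c R^c commute on `u`. -/
theorem quadruple_symm {q : K} (hq0 : q ≠ 0) (hq : ∀ n : ℕ, 0 < n → q ^ n ≠ 1)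
    {L R : Module.End K V} (hLR : QSerre q L R) (hRL : QSerre q R L) {G : ℤ → Submodule K V}
    (hG : ∀ j : ℤ, j < 0 → G j = ⊥) (hL : Shifts G (-1) L) (hR : Shifts G 1 R) {u : V}
    (hu : u ∈ G 0) (m c : ℕ) (hc : c ≤ m) (b : ℕ) (hb : b ≤ m) :
    (L ^ (m - c) * R ^ b * L ^ c * R ^ (m - b)) u =
      (L ^ (m - b) * R ^ c * L ^ b * R ^ (m - c)) u := by
  have hzero : ∀ b c : ℕ, b ≤ m → m < b + c →
      (L ^ (m - c) * R ^ b * L ^ c * R ^ (m - b)) u = 0 := by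
    intro b c hb hbc
    have := ((hL.pow c).mul (hR.pow (m - b))) 0 u hu
    rw [hG _ (by omega), Submodule.mem_bot] at this
    rw [mul_assoc, Module.End.mul_apply, this, map_zero]
  induction c using Nat.strong_induction_on generalizing b with
  | _ c ih =>
    obtain hlt | rfl | hlt := lt_trichotomy b c
    · exact (ih b hlt hb c hc).symm
    · rfl
    · by_cases hbc : m < b + c
      · rw [hzero b c hb hbc, hzero c b hc (by omega)]
      · rw [← sub_eq_zero, ← Submodule.mem_bot K]
        refine mem_of_isRelation hq0 hq (n := c) (m := m)
          (f := fun b => (L ^ (m - c) * R ^ b * L ^ c * R ^ (m - b)) u -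
            (L ^ (m - b) * R ^ c * L ^ b * R ^ (m - c)) u)
          (S := Finset.range (c + 1) ∪ Finset.Icc (m - c + 1) m) ?_ ?_ ?_ ?_ hb
        · intro w hw
          have h1 := congrArg (fun x => (L ^ (m - c) * x) u) (hRL.sum_eq_zero hq0 hq hw)
          have h2 := congrArg (fun x => (x * R ^ (m - c)) u) (hLR.sum_reflect_eq_zero hq0 hq hw)
          simp only [Finset.mul_sum, Finset.sum_mul, mul_smul_comm, smul_mul_assoc, mul_zero,
            zero_mul, LinearMap.sum_apply, LinearMap.smul_apply, LinearMap.zero_apply,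
            ← mul_assoc] at h1 h2
          simp only [smul_sub, Finset.sum_sub_distrib, h1, h2, sub_zero]
        · intro s hs
          simp only [Finset.mem_union, Finset.mem_range, Finset.mem_Icc] at hs ⊢
          omega
        · rw [Finset.card_union_of_disjoint, Finset.card_range, Nat.card_Icc]
          · omega
          · rw [Finset.disjoint_left]
            intro s hs
            simp only [Finset.mem_range, Finset.mem_Icc] at hs ⊢
            omega
        · intro s hs
          simp only [Finset.mem_union, Finset.mem_range, Finset.mem_Icc] at hs
          rw [Submodule.mem_bot, sub_eq_zero]
          obtain hs | hs := hs
          · obtain hsc | rfl := Nat.lt_succ_iff_lt_or_eq.mp hs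
            · exact (ih s hsc (by omega) c hc).symm
            · rfl
          · rw [hzero s c hs.2 (by omega), hzero c s hc (by omega)]

/-- If some member is not scalar on W, its eigenspace in W is a smaller invariant subspace;
induction on dimension needs no finiteness of the family. -/
theorem exists_common_eigenvector [IsAlgClosed K] [FiniteDimensional K V] {ι : Type*}
    (T : ι → Module.End K V) (W : Submodule K V) (hW : W ≠ ⊥)
    (hinv : ∀ i, ∀ w ∈ W, T i w ∈ W)
    (hcomm : ∀ i j, ∀ w ∈ W, T i (T j w) = T j (T i w)) :
    ∃ x ∈ W, x ≠ 0 ∧ ∀ i, ∃ μ : K, T i x = μ • x := by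
  obtain ⟨n, hn⟩ : ∃ n, Module.finrank K W = n := ⟨_, rfl⟩
  induction n using Nat.strong_induction_on generalizing W with
  | _ n ih =>
    by_cases hs : ∀ i, ∃ μ : K, ∀ w ∈ W, T i w = μ • w
    · obtain ⟨x, hxW, hx⟩ := W.exists_mem_ne_zero_of_ne_bot hW
      exact ⟨x, hxW, hx, fun i => (hs i).imp fun μ h => h x hxW⟩
    · push Not at hs
      obtain ⟨i, hi⟩ := hs
      have : Nontrivial W := Submodule.nontrivial_iff_ne_bot.mpr hW
      obtain ⟨μ, hμ⟩ := Module.End.exists_eigenvalue ((T i).restrict (hinv i))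
      obtain ⟨y, hy⟩ := hμ.exists_hasEigenvector
      have hy1 : T i y = μ • (y : V) := congrArg Subtype.val hy.apply_eq_smul
      have hy0 : (y : V) ≠ 0 := fun h => hy.2 (Subtype.ext h)
      have hlt : W ⊓ (T i).eigenspace μ < W := by
        refine lt_of_le_of_ne inf_le_left fun h => ?_
        obtain ⟨w, hw, hw'⟩ := hi μ
        rw [← h] at hw
        exact hw' (Module.End.mem_eigenspace_iff.mp hw.2)
      obtain ⟨x, hx, hx'⟩ := ih _ (hn ▸ Submodule.finrank_lt_finrank_of_lt hlt)
        (W ⊓ (T i).eigenspace μ)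
        (fun h => hy0 ((Submodule.mem_bot K).mp
          (h ▸ ⟨y.2, Module.End.mem_eigenspace_iff.mpr hy1⟩)))
        (fun j w hw => ⟨hinv j w hw.1, by
          rw [SetLike.mem_coe, Module.End.mem_eigenspace_iff, hcomm i j w hw.1,
            Module.End.mem_eigenspace_iff.mp hw.2, map_smul]⟩)
        (fun j k w hw => hcomm j k w hw.1) rfl
      exact ⟨x, hx.1, hx'⟩

/-- The strictly increasing lists of even length. -/
def evenSorted : Set (List ℕ) := {l | Even l.length ∧ l.Pairwise (· < ·)}

/-- A valley-free word that is not increasing ends in L^a R^b with b ≤ a: for b < a it kills `x` by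
degree, and for b = a it is a scalar on `x`, leaving a shorter even word. -/
theorem altProd_apply_mem_span_evenSorted {q : K} (hq0 : q ≠ 0)
    (hq : ∀ n : ℕ, 0 < n → q ^ n ≠ 1)
    {L R : Module.End K V} (hLR : QSerre q L R) (hRL : QSerre q R L) {G : ℤ → Submodule K V}
    (hG : ∀ j : ℤ, j < 0 → G j = ⊥) (hL : Shifts G (-1) L) (hR : Shifts G 1 R) {x : V}
    (hx : x ∈ G 0) (hμ : ∀ j : ℕ, ∃ μ : K, (L ^ j * R ^ j) x = μ • x) {l : List ℕ}
    (hl : Even l.length) :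
    altProd L R l x ∈ Submodule.span K ((fun l => altProd L R l x) '' evenSorted) := by
  have hvf : ∀ n : ℕ, ∀ l : List ℕ, l.length = n → Even n → ValleyFree l →
      altProd L R l x ∈ Submodule.span K ((fun l => altProd L R l x) '' evenSorted) := by
    intro n
    induction n using Nat.strong_induction_on with
    | _ n ih =>
      intro l hn he hv
      obtain h | ⟨l', a, b, rfl, hab⟩ := hv.pairwise_or
      · exact Submodule.subset_span ⟨l, ⟨hn ▸ he, h⟩, rfl⟩
      · simp only [List.length_append, List.length_cons, List.length_nil] at hn
        have he' : Even l'.length := by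
          rw [← hn] at he
          exact (Nat.even_add.mp he).mpr (by decide)
        rw [altProd_append, if_pos he', Module.End.mul_apply]
        simp only [altProd, mul_one]
        obtain rfl | hlt := eq_or_lt_of_le hab
        · obtain ⟨μ, h⟩ := hμ b
          rw [h, map_smul]
          exact Submodule.smul_mem _ _ (ih _ (by omega) l' rfl he' hv.of_append)
        · have := ((hL.pow a).mul (hR.pow b)) 0 x hx
          rw [hG _ (by omega), Submodule.mem_bot] at this
          rw [this, map_zero]
          exact Submodule.zero_mem _
  have := Submodule.mem_map_of_mem (f := LinearMap.applyₗ (R := K) x)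
    (altProd_mem_span_valleyFree hq0 hq hLR hRL l)
  rw [Submodule.map_span, ← Set.image_comp] at this
  refine Submodule.span_le.mpr ?_ this
  rintro _ ⟨l', ⟨hv, hlen⟩, rfl⟩
  exact hvf _ l' hlen hl hv

end Graded

/-! ### Counting the index sequences -/

section Counting

theorem altDeg_append (p l : List ℕ) :
    altDeg (p ++ l) = altDeg p + (-1) ^ p.length * altDeg l := by
  induction p with
  | nil => simp [altDeg]
  | cons a p ih =>
    simp only [List.cons_append, altDeg, ih, List.length_cons, pow_succ]
    ring

theorem altDeg_reverse (l : List ℕ) : altDeg l.reverse = (-1) ^ (l.length + 1) * altDeg l := by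
  induction l with
  | nil => simp [altDeg]
  | cons a l ih =>
    simp only [List.reverse_cons, altDeg_append, ih, altDeg, List.length_cons, List.length_reverse,
      pow_succ]
    ring

theorem sum_get_eq_altDeg (l : List ℕ) :
    ∑ h : Fin l.length, (-1 : ℤ) ^ ((h : ℕ) + 1) * (l.get h : ℤ) = altDeg l := by
  induction l with
  | nil => simp [altDeg]
  | cons a l ih =>
    rw [altDeg, ← ih]
    simp only [List.length_cons]
    rw [Fin.sum_univ_succ]
    simp only [List.get_cons_zero, Fin.val_zero, Fin.val_succ, pow_succ]
    simp

theorem mem_indexSeqs {d i : ℕ} {l : List ℕ} :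
    l ∈ indexSeqs d i ↔ l ∈ evenSorted ∧ (∀ k ∈ l, k ≤ d) ∧ altDeg l = i := by
  simp only [indexSeqs, evenSorted, Set.mem_ofPred_eq, sum_get_eq_altDeg, eq_comm, and_assoc]

/-- The strictly decreasing lists with entries at most `d`, of even length if and only if `p`
holds, and with alternating sum `i_1 - i_2 + i_3 - ⋯ = z`. -/
def decLists (d : ℕ) (p : Prop) (z : ℤ) : Set (List ℕ) :=
  {l | l.Pairwise (· > ·) ∧ (∀ k ∈ l, k ≤ d) ∧ (Even l.length ↔ p) ∧ -altDeg l = z}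

theorem decLists_zero (p : Prop) (z : ℤ) :
    ∃ l, decLists 0 p z = if z = 0 then {l} else ∅ := by
  have key : ∀ l : List ℕ, l.Pairwise (· > ·) → (∀ k ∈ l, k ≤ 0) → l = [] ∨ l = [0] := by
    intro l h1 h2
    match l with
    | [] => simp
    | [a] => simpa using h2
    | a :: b :: t =>
      have h3 : a > b := (List.pairwise_cons.mp h1).1 b (by simp)
      have := h2 a (by simp)
      omega
  by_cases hp : p
  · refine ⟨[], Set.ext fun l => ⟨fun ⟨h1, h2, h3, h4⟩ => ?_, fun h => ?_⟩⟩
    · obtain rfl | rfl := key l h1 h2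
      · simp [altDeg] at h4
        simp [← h4]
      · simp [hp] at h3
    · split_ifs at h with hz
      · obtain rfl : l = [] := h
        simp [decLists, altDeg, hz, hp]
      · exact absurd h (Set.notMem_empty _)
  · refine ⟨[0], Set.ext fun l => ⟨fun ⟨h1, h2, h3, h4⟩ => ?_, fun h => ?_⟩⟩
    · obtain rfl | rfl := key l h1 h2
      · simp [hp] at h3
      · simp [altDeg] at h4
        simp [← h4]
    · split_ifs at h with hz
      · obtain rfl : l = [0] := h
        simp [decLists, altDeg, hz, hp]
      · exact absurd h (Set.notMem_empty _)

/-- Deleting a leading d+1 flips both the parity of the length and the sign of the remaining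
alternating sum. -/
theorem decLists_succ (d : ℕ) (p : Prop) (z : ℤ) :
    decLists (d + 1) p z =
      decLists d p z ∪ List.cons (d + 1) '' decLists d (¬p) (d + 1 - z) := by
  ext l
  constructor
  · rintro ⟨h1, h2, h3, h4⟩
    match l with
    | [] => exact Or.inl ⟨h1, by simp, h3, h4⟩
    | a :: t =>
      rw [List.pairwise_cons] at h1
      by_cases ha : a ≤ d
      · refine Or.inl ⟨List.pairwise_cons.mpr h1, fun k hk => ?_, h3, h4⟩
        obtain rfl | hk := List.mem_cons.mp hk
        · exact ha
        · exact (h1.1 k hk).le.trans ha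
      · obtain rfl : a = d + 1 := by
          have := h2 a (by simp)
          omega
        refine Or.inr ⟨t, ⟨h1.2, fun k hk => Nat.lt_succ_iff.mp (h1.1 k hk), ?_, ?_⟩, rfl⟩
        · rw [List.length_cons, Nat.even_add_one] at h3
          tauto
        · rw [altDeg] at h4
          push_cast at h4
          omega
  · rintro (⟨h1, h2, h3, h4⟩ | ⟨t, ⟨h1, h2, h3, h4⟩, rfl⟩)
    · exact ⟨h1, fun k hk => (h2 k hk).trans (Nat.le_succ d), h3, h4⟩
    · refine ⟨List.pairwise_cons.mpr ⟨fun k hk => Nat.lt_succ_of_le (h2 k hk), h1⟩, ?_, ?_, ?_⟩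
      · intro k hk
        obtain rfl | hk := List.mem_cons.mp hk
        · exact le_rfl
        · exact (h2 k hk).trans (Nat.le_succ d)
      · rw [List.length_cons, Nat.even_add_one]
        tauto
      · rw [altDeg]
        push_cast
        omega

/-- The count does not depend on the parity condition, so the recursion closes; it is Pascal's rule
after C(d, d+1-z) = C(d, z-1). The test 0 ≤ z is needed since `toNat` sends negative z to 0. -/
theorem ncard_decLists (d : ℕ) (p : Prop) (z : ℤ) :
    (decLists d p z).Finite ∧
      (decLists d p z).ncard = if 0 ≤ z then d.choose z.toNat else 0 := by
  induction d generalizing p z with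
  | zero =>
    obtain ⟨l, hl⟩ := decLists_zero p z
    rw [hl]
    obtain rfl | hz := eq_or_ne z 0
    · simp
    · simp only [hz, if_false, Set.finite_empty, Set.ncard_empty, true_and]
      split_ifs with h
      · rw [Nat.choose_eq_zero_of_lt (by omega)]
      · rfl
  | succ d ih =>
    have hf := (ih (¬p) (d + 1 - z)).1.image (List.cons (d + 1))
    rw [decLists_succ]
    refine ⟨(ih p z).1.union hf, ?_⟩
    rw [Set.ncard_union_eq ?_ (ih p z).1 hf,
      Set.ncard_image_of_injective _ (List.cons_injective), (ih p z).2, (ih _ _).2]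
    · obtain hz | hz := lt_or_ge z 0
      · have h : (d + 1 - z : ℤ).toNat > d := by omega
        simp [hz.not_ge, Nat.choose_eq_zero_of_lt h]
      · lift z to ℕ using hz
        simp only [Int.natCast_nonneg, if_true, Int.toNat_natCast]
        obtain hlt | hle := lt_or_ge (d + 1) z
        · rw [if_neg (by omega), Nat.choose_eq_zero_of_lt (by omega),
            Nat.choose_eq_zero_of_lt hlt]
        · rw [if_pos (by omega), show ((d : ℤ) + 1 - z).toNat = d + 1 - z by omega]
          cases z with
          | zero => simp
          | succ z =>
            rw [Nat.choose_succ_succ, show d + 1 - (z + 1) = d - z by omega,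
              Nat.choose_symm (by omega), add_comm]
    · rw [Set.disjoint_left]
      rintro _ ⟨_, h2, _⟩ ⟨t, _, rfl⟩
      have := h2 (d + 1) (by simp)
      omega

/-- Reversal brings the largest entry to the head, where the recursion acts; in even length it
negates the alternating sum. -/
theorem ncard_indexSeqs (d i : ℕ) : (indexSeqs d i).ncard = d.choose i := by
  have h : indexSeqs d i = List.reverse '' decLists d True i := by
    have key : ∀ l : List ℕ, Even l.length → altDeg l.reverse = -altDeg l := by
      intro l hl
      rw [altDeg_reverse, pow_succ, hl.neg_one_pow]
      ring
    ext l
    rw [mem_indexSeqs]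
    constructor
    · rintro ⟨⟨h1, h2⟩, h3, h4⟩
      refine ⟨l.reverse, ⟨List.pairwise_reverse.mpr h2, by simpa using h3, by simpa using h1, ?_⟩,
        List.reverse_reverse l⟩
      rw [key l h1, neg_neg, h4]
    · rintro ⟨l, ⟨h1, h2, h3, h4⟩, rfl⟩
      have he : Even l.length := h3.mpr trivial
      exact ⟨⟨by simpa using he, List.pairwise_reverse.mpr h1⟩, by simpa using h2,
        by rw [key l he, h4]⟩
  rw [h, Set.ncard_image_of_injective _ List.reverse_injective, (ncard_decLists d True i).2]
  simp

end Counting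

end TDPair

/-! ### The grading by the split decomposition -/

noncomputable section

namespace TDPair

section SplitDecomposition

variable {K V : Type*} [Field K] [AddCommGroup V] [Module K V] {d : ℕ}

/-- The family `U_0, …, U_d` extended by zero to all integer indices. -/
def piece (U : Fin (d + 1) → Submodule K V) (j : ℤ) : Submodule K V :=
  if h : 0 ≤ j ∧ j ≤ d then U ⟨j.toNat, by omega⟩ else ⊥

theorem piece_coe (U : Fin (d + 1) → Submodule K V) (i : Fin (d + 1)) : piece U (i : ℕ) = U i := by
  rw [piece, dif_pos ⟨by omega, by omega⟩]
  congr

theorem piece_zero (U : Fin (d + 1) → Submodule K V) : piece U 0 = U 0 := piece_coe U 0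

theorem piece_eq_bot (U : Fin (d + 1) → Submodule K V) {j : ℤ} (hj : j < 0 ∨ d < j) :
    piece U j = ⊥ := dif_neg (by omega)

theorem forall_piece {U : Fin (d + 1) → Submodule K V} {P : ℤ → V → Prop} (h0 : ∀ j, P j 0)
    (h : ∀ i : Fin (d + 1), ∀ u ∈ U i, P (i : ℕ) u) : ∀ j, ∀ u ∈ piece U j, P j u := by
  intro j u hu
  by_cases hj : j < 0 ∨ d < j
  · rw [piece_eq_bot U hj, Submodule.mem_bot] at hu
    exact hu ▸ h0 j
  · obtain ⟨i, rfl⟩ : ∃ i : Fin (d + 1), ((i : ℕ) : ℤ) = j :=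
      ⟨⟨j.toNat, by omega⟩, by simp only; omega⟩
    rw [piece_coe] at hu
    exact h i u hu

theorem ext_of_isInternal {U : Fin (d + 1) → Submodule K V} (hU : DirectSum.IsInternal U)
    {f g : Module.End K V} (h : ∀ i, ∀ u ∈ U i, f u = g u) : f = g := by
  have : ⨆ i, U i ≤ LinearMap.eqLocus f g := iSup_le fun i u hu => h i u hu
  rw [hU.submodule_iSup_eq_top, top_le_iff] at this
  exact LinearMap.ext fun x => (this ▸ Submodule.mem_top : x ∈ LinearMap.eqLocus f g)

theorem sum_smul_proj_apply {U : Fin (d + 1) → Submodule K V} (hU : DirectSum.IsInternal U)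
    (c : Fin (d + 1) → K) {i : Fin (d + 1)} {u : V} (hu : u ∈ U i) :
    (∑ h, c h • proj hU h) u = c i • u := by
  simp [LinearMap.sum_apply, proj_apply hU _ i hu]

theorem shiftMap_apply {U : Fin (d + 1) → Submodule K V} (hU : DirectSum.IsInternal U)
    (A : Module.End K V) (θ : Fin (d + 1) → K) {i : Fin (d + 1)} {u : V} (hu : u ∈ U i) :
    shiftMap A θ hU u = (A - θ i • (1 : Module.End K V)) u := by
  simp [shiftMap, sum_smul_proj_apply hU θ hu]

theorem IsSplitDecomposition.shifts_raise {A B : Module.End K V} {θ θ' : Fin (d + 1) → K}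
    {U : Fin (d + 1) → Submodule K V} (hU : IsSplitDecomposition A B θ θ' U) :
    Shifts (piece U) 1 (shiftMap A θ hU.isInternal) := by
  refine forall_piece (fun j => by simp) fun i u hu => ?_
  rw [shiftMap_apply hU.isInternal A θ hu]
  by_cases hi : (i : ℕ) < d
  · have := hU.raise i ⟨i + 1, by omega⟩ rfl (Submodule.mem_map_of_mem hu)
    rw [← piece_coe U] at this
    simpa using this
  · obtain rfl : i = Fin.last d := Fin.ext (by simp only [Fin.val_last]; omega)
    have := Submodule.mem_map_of_mem (f := A - θ (Fin.last d) • (1 : Module.End K V)) hu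
    rw [hU.raise_last, Submodule.mem_bot] at this
    rw [this]
    exact Submodule.zero_mem _

theorem IsSplitDecomposition.shifts_lower {A B : Module.End K V} {θ θ' : Fin (d + 1) → K}
    {U : Fin (d + 1) → Submodule K V} (hU : IsSplitDecomposition A B θ θ' U) :
    Shifts (piece U) (-1) (shiftMap B θ' hU.isInternal) := by
  refine forall_piece (fun j => by simp) fun i u hu => ?_
  rw [shiftMap_apply hU.isInternal B θ' hu]
  by_cases hi : 0 < (i : ℕ)
  · have := hU.lower i ⟨i - 1, by omega⟩ (by simp only; omega) (Submodule.mem_map_of_mem hu)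
    rw [← piece_coe U] at this
    convert this using 2
    simp only
    omega
  · obtain rfl : i = 0 := Fin.ext (by simp only [Fin.val_zero]; omega)
    have := Submodule.mem_map_of_mem (f := B - θ' 0 • (1 : Module.End K V)) hu
    rw [hU.lower_zero, Submodule.mem_bot] at this
    rw [this]
    exact Submodule.zero_mem _

/-- The map acting on `U_i` as the scalar `q ^ (s * (2 * i - d))`. -/
def weightMap {U : Fin (d + 1) → Submodule K V} (hU : DirectSum.IsInternal U) (q : K) (s : ℤ) :
    Module.End K V :=
  ∑ h : Fin (d + 1), q ^ (s * (2 * (h : ℕ) - d)) • proj hU h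

theorem weightMap_apply {U : Fin (d + 1) → Submodule K V} (hU : DirectSum.IsInternal U) (q : K)
    (s : ℤ) : ∀ j, ∀ u ∈ piece U j, weightMap hU q s u = q ^ (s * (2 * j - d)) • u :=
  forall_piece (fun j => by simp) fun i u hu =>
    sum_smul_proj_apply hU (fun h => q ^ (s * (2 * (h : ℕ) - d))) hu

theorem weightMap_mul {U : Fin (d + 1) → Submodule K V} (hU : DirectSum.IsInternal U) {q : K}
    (hq0 : q ≠ 0) (s : ℤ) : weightMap hU q s * weightMap hU q (-s) = 1 := by
  refine ext_of_isInternal hU fun i u hu => ?_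
  rw [← piece_coe U] at hu
  rw [Module.End.mul_apply, weightMap_apply hU q _ _ u hu, map_smul, weightMap_apply hU q _ _ u hu,
    smul_smul, ← zpow_add₀ hq0, Module.End.one_apply]
  ring_nf
  simp

theorem weightMap_mul_of_shifts {U : Fin (d + 1) → Submodule K V} (hU : DirectSum.IsInternal U)
    {q : K} (hq0 : q ≠ 0) (s : ℤ) {e : ℤ} {T : Module.End K V} (hT : Shifts (piece U) e T) :
    weightMap hU q s * T = q ^ (s * (2 * e)) • (T * weightMap hU q s) := by
  refine ext_of_isInternal hU fun i u hu => ?_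
  rw [← piece_coe U] at hu
  rw [Module.End.mul_apply, weightMap_apply hU q _ _ _ (hT _ u hu), LinearMap.smul_apply,
    Module.End.mul_apply, weightMap_apply hU q _ _ u hu, map_smul, smul_smul, ← zpow_add₀ hq0]
  congr 2
  ring

theorem eq_shiftMap_add {U : Fin (d + 1) → Submodule K V} (hU : DirectSum.IsInternal U)
    (A : Module.End K V) {θ : Fin (d + 1) → K} {a q : K} {s : ℤ}
    (hθ : ∀ i : Fin (d + 1), θ i = a * q ^ (s * (2 * (i : ℕ) - d))) :
    A = shiftMap A θ hU + a • weightMap hU q s := by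
  rw [shiftMap, weightMap, Finset.smul_sum]
  simp only [smul_smul, ← hθ, sub_add_cancel]

/-- The span of the even words is invariant under A and B: k and k' scale each word, and R or L can
be prepended to it. -/
theorem eq_top_of_irreducible {A B R L k k' : Module.End K V} {a b : K}
    (hirr : ∀ W : Submodule K V, W.map A ≤ W → W.map B ≤ W → W = ⊥ ∨ W = ⊤)
    (hA : A = R + a • k) (hB : B = L + b • k') {x : V} (hx : x ≠ 0)
    (hk : ∀ l, ∃ c : K, k (altProd L R l x) = c • altProd L R l x)
    (hk' : ∀ l, ∃ c : K, k' (altProd L R l x) = c • altProd L R l x) :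
    Submodule.span K ((fun l => altProd L R l x) '' {l | Even l.length}) = ⊤ := by
  have hstep : ∀ (T S m : Module.End K V) (c : K), T = S + c • m →
      (∀ l, Even l.length → ∃ l' : List ℕ, Even l'.length ∧
        altProd L R l' x = S (altProd L R l x)) →
      (∀ l, ∃ c : K, m (altProd L R l x) = c • altProd L R l x) →
      (Submodule.span K ((fun l => altProd L R l x) '' {l | Even l.length})).map T ≤
        Submodule.span K ((fun l => altProd L R l x) '' {l | Even l.length}) := by
    intro T S m c hT hS hm
    rw [Submodule.map_span, Submodule.span_le]
    rintro _ ⟨_, ⟨l, hl, rfl⟩, rfl⟩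
    obtain ⟨l', hl', h⟩ := hS l hl
    obtain ⟨e, he⟩ := hm l
    simp only [hT, LinearMap.add_apply, LinearMap.smul_apply, he, ← h]
    exact add_mem (Submodule.subset_span ⟨l', hl', rfl⟩)
      (Submodule.smul_mem _ _ (Submodule.smul_mem _ _ (Submodule.subset_span ⟨l, hl, rfl⟩)))
  -- Zero exponents keep the length even: R = L⁰R¹ and L = L¹R⁰.
  refine (hirr _ (hstep A R k a hA (fun l hl => ⟨0 :: 1 :: l, ?_, ?_⟩) hk)
    (hstep B L k' b hB (fun l hl => ⟨1 :: 0 :: l, ?_, ?_⟩) hk')).resolve_left fun h => hx ?_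
  · simpa [Nat.even_add_one] using hl
  · simp [altProd]
  · simpa [Nat.even_add_one] using hl
  · simp [altProd]
  · rw [← Submodule.mem_bot K, ← h]
    exact Submodule.subset_span ⟨[], by simp, by simp [altProd]⟩

/-- If the vectors `altProd L R l x` with `l` increasing of even length span `V`, then those of the
right degree span each `U_i`. -/
theorem span_indexSeqs_eq {U : Fin (d + 1) → Submodule K V} (hU : DirectSum.IsInternal U)
    {R L : Module.End K V} (hR : Shifts (piece U) 1 R) (hL : Shifts (piece U) (-1) L) {x : V}
    (hx : x ∈ U 0)
    (htop : Submodule.span K ((fun l => altProd L R l x) '' evenSorted) = ⊤) (i : Fin (d + 1)) :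
    Submodule.span K ((fun l => altProd L R l x) '' indexSeqs d i) = U i := by
  have hmem : ∀ l, altProd L R l x ∈ piece U (altDeg l) := by
    intro l
    have := Shifts.altProd (e := 1) hL hR l 0 x (by rwa [piece_zero])
    simpa using this
  apply le_antisymm
  · rw [Submodule.span_le]
    rintro _ ⟨l, hl, rfl⟩
    have := hmem l
    rwa [(mem_indexSeqs.mp hl).2.2, piece_coe] at this
  · intro u hu
    have hu' : u ∈ Submodule.span K ((fun l => altProd L R l x) '' evenSorted) :=
      htop ▸ Submodule.mem_top
    -- Projecting a spanning expression to U_i keeps exactly the words of degree i; those with an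
    -- exponent above d are zero.
    have := Submodule.mem_map_of_mem (f := proj hU i) hu'
    rw [proj_apply hU i i hu, if_pos rfl, Submodule.map_span] at this
    refine Submodule.span_le.mpr ?_ this
    rintro _ ⟨_, ⟨l, hl, rfl⟩, rfl⟩
    have hproj : ∀ j, ∀ w ∈ piece U j, proj hU i w = if j = (i : ℕ) then w else 0 := by
      refine forall_piece (fun j => by simp) fun j w hw => ?_
      rw [proj_apply hU i j hw]
      simp only [Nat.cast_inj, Fin.val_inj]
    simp only [hproj _ _ (hmem l)]
    split_ifs with h
    · by_cases hb : ∀ k ∈ l, k ≤ d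
      · exact Submodule.subset_span ⟨l, mem_indexSeqs.mpr ⟨hl, hb, h⟩, rfl⟩
      · push Not at hb
        rw [altProd_apply_eq_zero (fun j hj => piece_eq_bot U hj) abs_one hL hR hb
          (i := 0) (by rwa [piece_zero])]
        exact Submodule.zero_mem _
    · exact Submodule.zero_mem _

end SplitDecomposition

end TDPair

end

/-! ### The main theorem -/

theorem theorem1p9 {K V : Type*} [Field K] [IsAlgClosed K] [CharZero K]
    [AddCommGroup V] [Module K V] [FiniteDimensional K V] [Nontrivial V]
    (q : K) (hq0 : q ≠ 0) (hq : ∀ n : ℕ, 0 < n → q ^ n ≠ 1)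
    (A Astar : Module.End K V) (hA : TDPair.IsTridiagonalPair A Astar)
    (hrel : TDPair.TridiagonalRelation (q ^ 2 + q ^ (-2 : ℤ)) 0 0 A Astar)
    (hrelstar : TDPair.TridiagonalRelation (q ^ 2 + q ^ (-2 : ℤ)) 0 0 Astar A)
    (d : ℕ) (θ θstar : Fin (d + 1) → K)
    (hθ : TDPair.IsStandardOrdering A Astar θ)
    (hθstar : TDPair.IsStandardOrdering Astar A θstar)
    (a astar : K)
    (ha : ∀ i : Fin (d + 1), θ i = a * q ^ (2 * (i : ℤ) - (d : ℤ)))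
    (hastar : ∀ i : Fin (d + 1), θstar i = astar * q ^ ((d : ℤ) - 2 * (i : ℤ)))
    (U : Fin (d + 1) → Submodule K V)
    (hU : TDPair.IsSplitDecomposition A Astar θ θstar U)
    (R L : Module.End K V)
    (hR : R = TDPair.shiftMap A θ hU.isInternal)
    (hL : L = TDPair.shiftMap Astar θstar hU.isInternal)
    (v : V) (hvU : v ∈ U 0) (hv : v ≠ 0) (i : Fin (d + 1)) :
    Submodule.span K ((fun l : List ℕ => TDPair.altProd L R l v) '' TDPair.indexSeqs d i) = U i ∧
      (TDPair.indexSeqs d i).ncard = d.choose i := by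
  open TDPair in
  refine ⟨?_, ncard_indexSeqs d i⟩
  have hRs : Shifts (piece U) 1 R := hR ▸ hU.shifts_raise
  have hLs : Shifts (piece U) (-1) L := hL ▸ hU.shifts_lower
  set k := weightMap hU.isInternal q 1 with hk
  set k' := weightMap hU.isInternal q (-1) with hk'
  have hAe : A = R + a • k := by
    rw [hR]
    exact eq_shiftMap_add hU.isInternal A fun i => by rw [ha, one_mul]
  have hBe : Astar = L + astar • k' := by
    rw [hL]
    exact eq_shiftMap_add hU.isInternal Astar fun i => by
      rw [hastar]
      congr 2
      ring
  have hkk' : k * k' = 1 := weightMap_mul hU.isInternal hq0 1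
  have hk'k : k' * k = 1 := by
    have := weightMap_mul hU.isInternal hq0 (-1)
    rwa [neg_neg] at this
  have hRL : QSerre q R L := by
    refine qSerre_of_relation hq0 hq hkk' hk'k ?_ ?_ a astar ?_
    · have := weightMap_mul_of_shifts hU.isInternal hq0 1 hRs
      norm_num at this
      exact_mod_cast this
    · have := weightMap_mul_of_shifts hU.isInternal hq0 1 hLs
      rwa [show (1 : ℤ) * (2 * -1) = -2 by norm_num] at this
    · rw [← hAe, ← hBe]
      exact serrePolar_of_tridiagonalRelation hrel
  have hLR : QSerre q L R := by
    refine qSerre_of_relation hq0 hq hk'k hkk' ?_ ?_ astar a ?_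
    · have := weightMap_mul_of_shifts hU.isInternal hq0 (-1) hLs
      norm_num at this
      exact_mod_cast this
    · have := weightMap_mul_of_shifts hU.isInternal hq0 (-1) hRs
      rwa [show (-1 : ℤ) * (2 * 1) = -2 by norm_num] at this
    · rw [← hAe, ← hBe]
      exact serrePolar_of_tridiagonalRelation hrelstar
  have hbot : ∀ j : ℤ, j < 0 → piece U j = ⊥ := fun j hj => piece_eq_bot U (Or.inl hj)
  -- Stated for any common eigenvector because it is used twice: for `x`, to show that U_0 is a
  -- line, and then for `v`.
  have hspan : ∀ x ∈ U 0, x ≠ 0 → (∀ j : ℕ, ∃ μ : K, (L ^ j * R ^ j) x = μ • x) →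
      Submodule.span K ((fun l => altProd L R l x) '' evenSorted) = ⊤ := by
    intro x hx hx0 hμ
    rw [← piece_zero U] at hx
    have hw : ∀ s l, ∃ c : K,
        weightMap hU.isInternal q s (altProd L R l x) = c • altProd L R l x := fun s l =>
      ⟨_, weightMap_apply hU.isInternal q s _ _ (Shifts.altProd (e := 1) hLs hRs l 0 x hx)⟩
    rw [eq_top_iff, ← eq_top_of_irreducible hA.irreducible hAe hBe hx0 (hw 1) (hw (-1)),
      Submodule.span_le]
    rintro _ ⟨l, hl, rfl⟩
    exact altProd_apply_mem_span_evenSorted hq0 hq hLR hRL hbot hLs hRs hx hμ hl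
  obtain ⟨x, hxU, hx0, hxμ⟩ := exists_common_eigenvector (fun j : ℕ => L ^ j * R ^ j) (U 0)
    (fun h => hv ((Submodule.mem_bot K).mp (h ▸ hvU)))
    (fun j w hw => by
      rw [← piece_zero U] at hw ⊢
      have := ((hLs.pow j).mul (hRs.pow j)) 0 w hw
      simpa using this)
    (fun b c w hw => by
      rw [← piece_zero U] at hw
      have := quadruple_symm hq0 hq hLR hRL hbot hLs hRs hw (b + c) c (by omega) b (by omega)
      simpa [mul_assoc] using this)
  -- In degree 0 the only increasing even word is empty.
  have hU0 : U 0 = Submodule.span K {x} := by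
    rw [← span_indexSeqs_eq hU.isInternal hRs hLs hxU (hspan x hxU hx0 hxμ) 0]
    refine le_antisymm (Submodule.span_mono ?_) (Submodule.span_mono ?_)
    · rintro _ ⟨l, hl, rfl⟩
      obtain ⟨⟨he, hs⟩, -, h⟩ := mem_indexSeqs.mp hl
      obtain rfl := eq_nil_of_altDeg_eq_zero hs he h
      simp [altProd]
    · rintro _ rfl
      exact ⟨[], mem_indexSeqs.mpr ⟨⟨by simp, by simp⟩, by simp, by simp [altDeg]⟩, by simp [altProd]⟩
  obtain ⟨c, rfl⟩ := Submodule.mem_span_singleton.mp (hU0 ▸ hvU)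
  refine span_indexSeqs_eq hU.isInternal hRs hLs hvU (hspan _ hvU hv fun j => ?_) i
  obtain ⟨μ, hμ⟩ := hxμ j
  exact ⟨μ, by rw [map_smul, hμ, smul_comm]⟩
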